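/- Let $(\mathcal X,\mathfrak X)$ be a measurable space with $\{x\}\in\mathfrak X$ for all $x\in\mathcal X$, let $q\ge 1$ be an integer, let $\mathcal H_q$ be the complex Hermitian $q\times q$ matrices, and let $\mathcal E$ be a finite-dimensional real vector space of measurable maps $F\colon\mathcal X\to\mathcal H_q$. A positive $\mathcal H_q$-valued measure $\mu$ on $(\mathcal X,\mathfrak X)$ is a countably additive map from $\mathfrak X$ to the positive semidefinite $q\times q$ matrices. Let $\tau=\operatorname{tr}\mu$ be its trace measure and $\Phi$ its Radon--Nikodym matrix with respect to $\tau$, with $\Phi(x)\succeq 0$ for all $x$. A linear functional $\Lambda\colon\mathcal E\to\mathbb R$ is a moment functional if it has a representing measure, that is, a positive $\mathcal H_q$-valued measure $\mu$ such that for every $F\in\mathcal E$ the function $\langle F,\Phi\rangle=\operatorname{tr}(F\Phi)$ is $\tau$-integrable and $\Lambda(F)=\int_{\mathcal X}\langle F,\Phi\rangle\,d\tau$. Let $\mathcal M_\Lambda$ be the set of all representing measures of $\Lambda$, and put $$\mathcal W(\Lambda)=\bigcup_{\mu\in\mathcal M_\Lambda}\{x\in\mathcal X:\mu(\{x\})\ne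 0\},\qquad \mathbf W(\Lambda;x)=\bigcup_{\mu\in\mathcal M_\Lambda}\operatorname{ran}\mu(\{x\})\subseteq\mathbb C^q\quad(x\in\mathcal X).$$ Define $\mathcal V_0(\Lambda)=\mathcal X$ and $\mathbf V_0(\Lambda;x)=\mathbb C^q$ for $x\in\mathcal X$. For $j\ge 1$, with $P_{j-1}(x)$ the orthogonal projection of $\mathbb C^q$ onto $\mathbf V_{j-1}(\Lambda;x)$ and $P_{j-1}^\perp=I-P_{j-1}$, define recursively $$\mathcal N_j(\Lambda)=\{F\in\ker\Lambda:(P_{j-1}FP_{j-1})(x)\succeq 0\text{ for all }x\in\mathcal V_{j-1}(\Lambda)\},$$ $$\mathcal V_j(\Lambda)=\bigcap_{F\in\mathcal N_j(\Lambda)}\{x\in\mathcal V_{j-1}(\Lambda):\det(P_{j-1}FP_{j-1}+P_{j-1}^\perp)(x)=0\},$$ $$\mathbf V_j(\Lambda;x)=\bigcap_{F\in\mathcal N_j(\Lambda)}\ker(P_{j-1}FP_{j-1}+P_{j-1}^\perp)(x)\qquad(x\in\mathcal V_{j-1}(\Lambda)).$$ The core set of $\Lambda$ is $\mathcal V(\Lambda)=\bigcap_{j\ge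 0}\mathcal V_j(\Lambda)$, and $\mathbf V(\Lambda;x)=\bigcap_{j\ge 0}\mathbf V_j(\Lambda;x)$ for $x\in\mathcal V(\Lambda)$. Theorem. Let $\Lambda\ne 0$ be a moment functional on $\mathcal E$. Then $\mathcal W(\Lambda)=\mathcal V(\Lambda)$, and $\mathbf W(\Lambda;x)=\mathbf V(\Lambda;x)$ for all $x\in\mathcal W(\Lambda)$. Moreover, $\mathcal W(\Lambda)\in\mathfrak X$ and $\mathcal W(\Lambda)\ne\emptyset$. -/

import Mathlib

open MeasureTheory Matrix
open scoped ComplexOrder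

/-! ### Positive matrix-valued measures -/

/-- A positive `ℋ_q`-valued measure on `X`: a countably additive set function whose values are
positive semidefinite (in particular Hermitian) complex `q × q` matrices. -/
structure PosMatrixMeasure (X : Type*) [MeasurableSpace X] (q : ℕ) where
  toVectorMeasure : VectorMeasure X (Matrix (Fin q) (Fin q) ℂ)
  posSemidef : ∀ A : Set X, MeasurableSet A → (toVectorMeasure A).PosSemidef

/-- Measurability of a matrix-valued map, entry by entry (that is, with respect to the Borel
`σ`-algebra of the matrix space). -/
def MatrixMeasurable {X : Type*} [MeasurableSpace X] {q : ℕ}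
    (F : X → Matrix (Fin q) (Fin q) ℂ) : Prop :=
  ∀ i j, Measurable fun x => F x i j

/-- The scalar product `⟨A, B⟩ = tr (A* B)`, which is real for Hermitian `A`, `B`. -/
noncomputable def matrixInner {q : ℕ} (A B : Matrix (Fin q) (Fin q) ℂ) : ℝ :=
  (Aᴴ * B).trace.re

namespace PosMatrixMeasure

variable {X : Type*} [MeasurableSpace X] {q : ℕ}

/-- The signed measure `A ↦ Re tr μ(A)`. -/
noncomputable def traceSigned (μ : PosMatrixMeasure X q) : SignedMeasure X :=
  μ.toVectorMeasure.mapRange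
    (Complex.reAddGroupHom.comp (Matrix.traceAddMonoidHom (Fin q) ℂ))
    (Complex.continuous_re.comp (Continuous.matrix_trace continuous_id))

theorem traceSigned_nonneg (μ : PosMatrixMeasure X q) : 0 ≤[Set.univ] μ.traceSigned := by
  refine VectorMeasure.restrict_le_restrict_of_subset_le _ _ fun A hA _ => ?_
  exact (Complex.le_def.1 (μ.posSemidef A hA).trace_nonneg).1

/-- The trace measure `τ = tr μ`, a finite positive scalar measure. -/
noncomputable def traceMeasure (μ : PosMatrixMeasure X q) : Measure X :=
  μ.traceSigned.toMeasureOfZeroLE Set.univ MeasurableSet.univ μ.traceSigned_nonneg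

theorem traceMeasure_real (μ : PosMatrixMeasure X q) {A : Set X} (hA : MeasurableSet A) :
    μ.traceMeasure.real A = (μ.toVectorMeasure A).trace.re := by
  rw [traceMeasure, SignedMeasure.toMeasureOfZeroLE_real_apply _ _ _ hA, Set.univ_inter]
  rfl

instance (μ : PosMatrixMeasure X q) : IsFiniteMeasure μ.traceMeasure := by
  unfold traceMeasure; infer_instance

/-- `Φ` is a Radon--Nikodym matrix of `μ` with respect to its trace measure `τ`: it is measurable,
positive semidefinite at every point, and `μ(A) = ∫_A Φ dτ` for all measurable `A`. -/
structure IsDensity (μ : PosMatrixMeasure X q) (Φ : X → Matrix (Fin q) (Fin q) ℂ) : Prop where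
  measurable : MatrixMeasurable Φ
  posSemidef : ∀ x, (Φ x).PosSemidef
  integrable : ∀ i j, Integrable (fun x => Φ x i j) μ.traceMeasure
  setIntegral : ∀ A, MeasurableSet A → ∀ i j,
    ∫ x in A, Φ x i j ∂μ.traceMeasure = μ.toVectorMeasure A i j

theorem exists_scalarDensity (μ : PosMatrixMeasure X q) (f : Matrix (Fin q) (Fin q) ℂ →+ ℝ)
    (hf : Continuous f) : ∃ g : X → ℝ, Measurable g ∧ Integrable g μ.traceMeasure ∧
      ∀ A, MeasurableSet A → ∫ x in A, g x ∂μ.traceMeasure = f (μ.toVectorMeasure A) := by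
  set s : SignedMeasure X := μ.toVectorMeasure.mapRange f hf with hs
  have hac : s ≪ᵥ μ.traceMeasure.toENNRealVectorMeasure := by
    refine VectorMeasure.AbsolutelyContinuous.mk fun A hA h0 => ?_
    rw [Measure.toENNRealVectorMeasure_apply_measurable hA] at h0
    have h1 : (μ.toVectorMeasure A).trace.re = 0 := by
      rw [← μ.traceMeasure_real hA, measureReal_def, h0]; rfl
    have hp := μ.posSemidef A hA
    have h2 : (μ.toVectorMeasure A).trace = 0 :=
      Complex.ext h1 (Complex.le_def.1 hp.trace_nonneg).2.symm
    have h3 : μ.toVectorMeasure A = 0 := hp.trace_eq_zero_iff.1 h2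
    rw [hs, VectorMeasure.mapRange_apply, h3, map_zero]
  refine ⟨s.rnDeriv μ.traceMeasure, SignedMeasure.measurable_rnDeriv _ _,
    SignedMeasure.integrable_rnDeriv _ _, fun A hA => ?_⟩
  rw [← withDensityᵥ_apply (SignedMeasure.integrable_rnDeriv _ _) hA,
    SignedMeasure.withDensityᵥ_rnDeriv_eq _ _ hac]
  rfl

/-- The Radon--Nikodym theorem: a Radon--Nikodym matrix exists. -/
theorem exists_isDensity (μ : PosMatrixMeasure X q) : ∃ Φ, μ.IsDensity Φ := by
  have hre : ∀ i j, Continuous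
      (Complex.reAddGroupHom.comp (Matrix.entryAddMonoidHom ℂ (i : Fin q) (j : Fin q))) :=
    fun i j => Complex.continuous_re.comp (continuous_id.matrix_elem i j)
  have him : ∀ i j, Continuous
      (Complex.imAddGroupHom.comp (Matrix.entryAddMonoidHom ℂ (i : Fin q) (j : Fin q))) :=
    fun i j => Complex.continuous_im.comp (continuous_id.matrix_elem i j)
  choose a ham hai ha using fun i j => μ.exists_scalarDensity _ (hre i j)
  choose b hbm hbi hb using fun i j => μ.exists_scalarDensity _ (him i j)
  let φ : X → Matrix (Fin q) (Fin q) ℂ := fun x i j => (a i j x : ℂ) + (b i j x : ℂ) * Complex.I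
  have hφm : ∀ i j, Measurable fun x => φ x i j := fun i j =>
    (Complex.measurable_ofReal.comp (ham i j)).add
      ((Complex.measurable_ofReal.comp (hbm i j)).mul_const _)
  have hφi : ∀ i j, Integrable (fun x => φ x i j) μ.traceMeasure := fun i j =>
    (hai i j).ofReal.add ((hbi i j).ofReal.mul_const _)
  have hφ : ∀ A, MeasurableSet A → ∀ i j,
      ∫ x in A, φ x i j ∂μ.traceMeasure = μ.toVectorMeasure A i j := by
    intro A hA i j
    have e : ∫ x in A, φ x i j ∂μ.traceMeasure
        = ∫ x in A, ((a i j x : ℂ) + (b i j x : ℂ) * Complex.I) ∂μ.traceMeasure := rfl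
    rw [e, integral_add (hai i j).integrableOn.ofReal
      ((hbi i j).integrableOn.ofReal.mul_const _), integral_mul_const,
      integral_complex_ofReal, integral_complex_ofReal, ha i j A hA, hb i j A hA]
    exact Complex.re_add_im _
  have hherm : ∀ᵐ x ∂μ.traceMeasure, (φ x).IsHermitian := by
    have : ∀ i j, (fun x => star (φ x j i)) =ᵐ[μ.traceMeasure] fun x => φ x i j := by
      intro i j
      refine Integrable.ae_eq_of_forall_setIntegral_eq _ _
        ((Complex.conjLIE.toContinuousLinearEquiv.toContinuousLinearMap).integrable_comp
          (hφi j i)) (hφi i j) fun A hA _ => ?_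
      have e : ∫ x in A, star (φ x j i) ∂μ.traceMeasure
          = star (∫ x in A, φ x j i ∂μ.traceMeasure) := integral_conj
      rw [e, hφ A hA, hφ A hA]
      exact (μ.posSemidef A hA).1.apply i j
    filter_upwards [ae_all_iff.2 fun i => ae_all_iff.2 fun j => this i j] with x hx
    exact Matrix.IsHermitian.ext hx
  have hquad : ∀ v : Fin q → ℂ, ∀ᵐ x ∂μ.traceMeasure, 0 ≤ (star v ⬝ᵥ φ x *ᵥ v).re := by
    intro v
    have hexp : ∀ M : Matrix (Fin q) (Fin q) ℂ,
        star v ⬝ᵥ M *ᵥ v = ∑ i, ∑ j, (star (v i) * v j) * M i j := by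
      intro M
      simp only [dotProduct, mulVec, Finset.mul_sum, Pi.star_apply]
      exact Finset.sum_congr rfl fun i _ => Finset.sum_congr rfl fun j _ => by ring
    have hint : Integrable (fun x => star v ⬝ᵥ φ x *ᵥ v) μ.traceMeasure := by
      simp only [hexp]
      exact integrable_finsetSum _ fun i _ => integrable_finsetSum _ fun j _ =>
        (hφi i j).const_mul _
    refine ae_nonneg_of_forall_setIntegral_nonneg hint.re fun A hA _ => ?_
    have h1 : ∫ x in A, star v ⬝ᵥ φ x *ᵥ v ∂μ.traceMeasure
        = star v ⬝ᵥ (μ.toVectorMeasure A) *ᵥ v := by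
      simp only [hexp]
      rw [integral_finsetSum _ fun i _ => integrable_finsetSum _ fun j _ =>
        ((hφi i j).const_mul _).integrableOn]
      refine Finset.sum_congr rfl fun i _ => ?_
      rw [integral_finsetSum _ fun j _ => ((hφi i j).const_mul _).integrableOn]
      exact Finset.sum_congr rfl fun j _ => by rw [integral_const_mul, hφ A hA]
    have h2 : ∫ x in A, (star v ⬝ᵥ φ x *ᵥ v).re ∂μ.traceMeasure
        = (∫ x in A, star v ⬝ᵥ φ x *ᵥ v ∂μ.traceMeasure).re :=
      integral_re hint.integrableOn (μ := μ.traceMeasure.restrict A)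
    refine le_of_le_of_eq ?_ h2.symm
    rw [h1]
    exact (Complex.le_def.1 ((μ.posSemidef A hA).dotProduct_mulVec_nonneg v)).1
  have hpos : ∀ᵐ x ∂μ.traceMeasure, (φ x).PosSemidef := by
    filter_upwards [hherm, ae_all_iff.2 fun n =>
      hquad (TopologicalSpace.denseSeq (Fin q → ℂ) n)] with x hx hn
    refine Matrix.PosSemidef.of_dotProduct_mulVec_nonneg hx fun v => ?_
    have hcl : IsClosed {v : Fin q → ℂ | 0 ≤ (star v ⬝ᵥ φ x *ᵥ v).re} := by
      refine isClosed_le continuous_const (Complex.continuous_re.comp ?_)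
      exact continuous_star.dotProduct (continuous_const.matrix_mulVec continuous_id)
    have hre0 : 0 ≤ (star v ⬝ᵥ φ x *ᵥ v).re := by
      have := (TopologicalSpace.denseRange_denseSeq (Fin q → ℂ)).closure_range
      have hv : v ∈ closure (Set.range (TopologicalSpace.denseSeq (Fin q → ℂ))) := by
        rw [this]; trivial
      exact closure_minimal (by rintro _ ⟨n, rfl⟩; exact hn n) hcl hv
    exact Complex.le_def.2 ⟨hre0, (hx.im_star_dotProduct_mulVec_self v).symm⟩
  set N := toMeasurable μ.traceMeasure {x | ¬ (φ x).PosSemidef} with hN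
  have hNm : MeasurableSet N := measurableSet_toMeasurable _ _
  have hN0 : μ.traceMeasure N = 0 := by rw [hN, measure_toMeasurable]; exact hpos
  classical
  let Φ : X → Matrix (Fin q) (Fin q) ℂ := fun x => if x ∈ N then 0 else φ x
  have hae : ∀ i j, (fun x => φ x i j) =ᵐ[μ.traceMeasure] fun x => Φ x i j := by
    intro i j
    have : ∀ᵐ x ∂μ.traceMeasure, x ∉ N := measure_eq_zero_iff_ae_notMem.1 hN0
    filter_upwards [this] with x hx
    simp only [Φ, if_neg hx]
  refine ⟨Φ, fun i j => ?_, fun x => ?_, fun i j => (hφi i j).congr (hae i j), fun A hA i j => ?_⟩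
  · have : (fun x => Φ x i j) = N.piecewise (fun _ => 0) fun x => φ x i j := by
      funext x
      by_cases hx : x ∈ N <;> simp [Φ, hx]
    rw [this]
    exact Measurable.piecewise hNm measurable_const (hφm i j)
  · by_cases hx : x ∈ N
    · simp only [Φ, if_pos hx]; exact Matrix.PosSemidef.zero
    · simp only [Φ, if_neg hx]
      by_contra h
      exact hx (subset_toMeasurable _ _ h)
  · rw [← hφ A hA i j]
    exact (integral_congr_ae (ae_restrict_of_ae (hae i j))).symm

/-- The Radon--Nikodym matrix `Φ` of `μ` with respect to its trace measure. -/
noncomputable def density (μ : PosMatrixMeasure X q) : X → Matrix (Fin q) (Fin q) ℂ :=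
  Classical.choose μ.exists_isDensity

theorem density_spec (μ : PosMatrixMeasure X q) : μ.IsDensity μ.density :=
  Classical.choose_spec μ.exists_isDensity

/-- `F` is `μ`-integrable: `⟨F, Φ⟩ ∈ L¹(τ)`. -/
def MIntegrable (μ : PosMatrixMeasure X q) (F : X → Matrix (Fin q) (Fin q) ℂ) : Prop :=
  Integrable (fun x => matrixInner (F x) (μ.density x)) μ.traceMeasure

/-- The integral `∫ ⟨F, dμ⟩ = ∫ ⟨F, Φ⟩ dτ`. -/
noncomputable def mIntegral (μ : PosMatrixMeasure X q)
    (F : X → Matrix (Fin q) (Fin q) ℂ) : ℝ :=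
  ∫ x, matrixInner (F x) (μ.density x) ∂μ.traceMeasure

end PosMatrixMeasure

/-! ### Moment functionals and their atoms -/

section MomentFunctional

variable {X : Type*} [MeasurableSpace X] {q : ℕ}
  {E : Submodule ℝ (X → Matrix (Fin q) (Fin q) ℂ)}

/-- The set `ℳ_Λ` of representing measures of a linear functional `Λ` on `E`. -/
def representingMeasures (Λ : E →ₗ[ℝ] ℝ) : Set (PosMatrixMeasure X q) :=
  {μ | (∀ F : E, μ.MIntegrable (F : X → Matrix (Fin q) (Fin q) ℂ)) ∧
    ∀ F : E, Λ F = μ.mIntegral (F : X → Matrix (Fin q) (Fin q) ℂ)}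

/-- `Λ` is a moment functional if it has a representing measure. -/
def IsMomentFunctional (Λ : E →ₗ[ℝ] ℝ) : Prop :=
  ∃ μ : PosMatrixMeasure X q, μ ∈ representingMeasures Λ

/-- The set of atoms `𝒲(Λ)`. -/
def atomSet (Λ : E →ₗ[ℝ] ℝ) : Set X :=
  ⋃ μ ∈ representingMeasures Λ, {x | μ.toVectorMeasure {x} ≠ 0}

/-- The set `𝐖(Λ; x)`: the union of the ranges of `μ({x})` over all representing measures `μ`. -/
def atomSpace (Λ : E →ₗ[ℝ] ℝ) (x : X) : Set (EuclideanSpace ℂ (Fin q)) :=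
  ⋃ μ ∈ representingMeasures Λ,
    (LinearMap.range (Matrix.toEuclideanLin (μ.toVectorMeasure {x})) :
      Set (EuclideanSpace ℂ (Fin q)))

/-! ### The core set -/

/-- The matrix of the orthogonal projection of `ℂ^q` onto the subspace `U`. -/
noncomputable def projMatrix (U : Submodule ℂ (EuclideanSpace ℂ (Fin q))) :
    Matrix (Fin q) (Fin q) ℂ :=
  (Matrix.toEuclideanCLM (n := Fin q) (𝕜 := ℂ)).symm U.starProjection

/-- Given a set `S ⊆ X` and a family of subspaces `U x ⊆ ℂ^q`, with `P(x)` the orthogonal projection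
onto `U x`: all `F ∈ ker Λ` such that `P(x) F(x) P(x) ⪰ 0` for all `x ∈ S`. -/
def coreCone (Λ : E →ₗ[ℝ] ℝ) (S : Set X)
    (U : X → Submodule ℂ (EuclideanSpace ℂ (Fin q))) : Set E :=
  {F | Λ F = 0 ∧
    ∀ x ∈ S, (projMatrix (U x) * (F : X → Matrix (Fin q) (Fin q) ℂ) x *
      projMatrix (U x)).PosSemidef}

/-- The matrix `P F P + P^⊥`, where `P` is the orthogonal projection onto `U`. -/
noncomputable def compress (U : Submodule ℂ (EuclideanSpace ℂ (Fin q)))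
    (F : Matrix (Fin q) (Fin q) ℂ) : Matrix (Fin q) (Fin q) ℂ :=
  projMatrix U * F * projMatrix U + (1 - projMatrix U)

/-- The pair `(𝒱_j(Λ), 𝐕_j(Λ; ·))`, defined by recursion on `j`. In the step from `j` to `j + 1`
the new set is a subset of the old one. The new subspace at `x` is given by its formula for every
`x : X`; only its values at points of the old set are ever used. -/
noncomputable def coreStage (Λ : E →ₗ[ℝ] ℝ) :
    ℕ → Set X × (X → Submodule ℂ (EuclideanSpace ℂ (Fin q)))
  | 0 => (Set.univ, fun _ => ⊤)
  | j + 1 =>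
    let S := (coreStage Λ j).1
    let U := (coreStage Λ j).2
    ({x | x ∈ S ∧ ∀ F ∈ coreCone Λ S U,
        (compress (U x) ((F : X → Matrix (Fin q) (Fin q) ℂ) x)).det = 0},
      fun x => ⨅ F ∈ coreCone Λ S U,
        LinearMap.ker (Matrix.toEuclideanLin
          (compress (U x) ((F : X → Matrix (Fin q) (Fin q) ℂ) x))))

/-- The core set `𝒱(Λ) = ⋂_j 𝒱_j(Λ)`. -/
noncomputable def coreSet (Λ : E →ₗ[ℝ] ℝ) : Set X :=
  ⋂ j : ℕ, (coreStage Λ j).1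

/-- The subspace `𝐕(Λ; x) = ⋂_j 𝐕_j(Λ; x)`. -/
noncomputable def coreSpace (Λ : E →ₗ[ℝ] ℝ) (x : X) : Submodule ℂ (EuclideanSpace ℂ (Fin q)) :=
  ⨅ j : ℕ, (coreStage Λ j).2 x

end MomentFunctional

/-! ### Quadratic forms, compressions and ranges of positive semidefinite matrices. -/

section QuadForm

variable {q : ℕ}

/-! Everything is expressed through the functionals `l_{x,v}(F) = ⟪v, F(x) v⟫` (`pointFunctional`).
Write `V_j(x)` for the subspaces of stage `j`. The cone used at stage `j` consists of the `F ∈ ker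
Λ` with `l_{x,v}(F) ≥ 0` for all `x` and `v ∈ V_j(x)`, and `V_{j+1}(x)` keeps those `v ∈ V_j(x)` at
which all these `F` give `0` (`mem_coreStage_succ_iff`). The cones increase and `E` is
finite-dimensional, so the recursion stops at some `n` (`exists_coreStage_stable`).

Atoms lie in the core: let `Φ` be the density of a representing measure, with range in `V_j` almost
everywhere. For `F` in the cone, `⟨F, Φ⟩` is nonnegative with integral `Λ F = 0`, hence vanishes
almost everywhere. Splitting `Φ` into rank one terms `w wᴴ` puts each `w` into `V_{j+1}`
(`ae_range_density_le_coreStage`). An atom is not a null set, so the inclusion holds there.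

The core consists of atoms: let `S` be the set of all `l_{y,u}` with `u ∈ V_n(y)`. If `F` is
nonnegative on `S`, then `Λ F ≥ 0`; if moreover `Λ F = 0`, then `F` is in the stationary cone and
vanishes on `S`. Hence `Λ` is in the relative interior of the cone generated by `S`, and `Λ - ε
l_{x,v}` is still in that cone for small `ε > 0`. It has a finitely atomic representing measure, and
adding `ε v vᴴ δ_x` gives one for `Λ` with `v` in the range at `x` (`coreSpace_subset_atomSpace`).

Measurability: each stage is the kernel field of a single measurable matrix map
(`exists_coreStage_succ_eq_ker`), and kernel projections depend measurably on the matrix.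
Nonemptiness: a trivial core forces `Φ = 0` almost everywhere, so `Λ = 0`. -/

/-- The real part of the quadratic form `v ↦ ⟪v, M v⟫`. -/
noncomputable def quadForm (M : Matrix (Fin q) (Fin q) ℂ) (v : EuclideanSpace ℂ (Fin q)) : ℝ :=
  (inner ℂ v (Matrix.toEuclideanLin M v)).re

theorem toEuclideanLin_mul_apply (A B : Matrix (Fin q) (Fin q) ℂ) (v : EuclideanSpace ℂ (Fin q)) :
    toEuclideanLin (A * B) v = toEuclideanLin A (toEuclideanLin B v) := by
  simp only [← coe_toEuclideanCLM_eq_toEuclideanLin, map_mul]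
  rfl

theorem toEuclideanLin_one_apply (v : EuclideanSpace ℂ (Fin q)) :
    toEuclideanLin (1 : Matrix (Fin q) (Fin q) ℂ) v = v := by
  simp only [← coe_toEuclideanCLM_eq_toEuclideanLin, map_one]
  rfl

theorem toEuclideanLin_projMatrix (U : Submodule ℂ (EuclideanSpace ℂ (Fin q)))
    (v : EuclideanSpace ℂ (Fin q)) :
    toEuclideanLin (projMatrix U) v = U.starProjection v := by
  rw [← coe_toEuclideanCLM_eq_toEuclideanLin, projMatrix, StarAlgEquiv.apply_symm_apply]
  rfl

theorem inner_toEuclideanLin_conjTranspose (A : Matrix (Fin q) (Fin q) ℂ)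
    (v w : EuclideanSpace ℂ (Fin q)) :
    inner ℂ (toEuclideanLin Aᴴ v) w = inner ℂ v (toEuclideanLin A w) := by
  rw [toEuclideanLin_conjTranspose_eq_adjoint, LinearMap.adjoint_inner_left]

theorem isHermitian_projMatrix (U : Submodule ℂ (EuclideanSpace ℂ (Fin q))) :
    (projMatrix U).IsHermitian := by
  refine isSymmetric_toEuclideanLin_iff.1 fun v w => ?_
  rw [toEuclideanLin_projMatrix, toEuclideanLin_projMatrix]
  exact Submodule.inner_starProjection_left_eq_right U v w

theorem quadForm_nonneg {M : Matrix (Fin q) (Fin q) ℂ} (hM : M.PosSemidef)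
    (v : EuclideanSpace ℂ (Fin q)) : 0 ≤ quadForm M v := by
  have h := (isPositive_toEuclideanLin_iff.2 hM).re_inner_nonneg_right v
  exact h

theorem posSemidef_of_quadForm_nonneg {M : Matrix (Fin q) (Fin q) ℂ} (hM : M.IsHermitian)
    (h : ∀ v, 0 ≤ quadForm M v) : M.PosSemidef := by
  refine isPositive_toEuclideanLin_iff.1 ⟨isSymmetric_toEuclideanLin_iff.2 hM, fun v => ?_⟩
  rw [← inner_conj_symm, RCLike.conj_re]
  exact h v

theorem quadForm_eq_zero_iff {M : Matrix (Fin q) (Fin q) ℂ} (hM : M.PosSemidef)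
    (v : EuclideanSpace ℂ (Fin q)) : quadForm M v = 0 ↔ toEuclideanLin M v = 0 := by
  constructor
  · intro h
    have h1 : inner ℂ v (toEuclideanLin M v) = 0 :=
      Complex.ext h (Complex.le_def.1
        ((isPositive_toEuclideanLin_iff.2 hM).inner_nonneg_right v)).2.symm
    have h2 : star v.ofLp ⬝ᵥ M *ᵥ v.ofLp = 0 := by
      rw [dotProduct_comm]
      simpa [EuclideanSpace.inner_eq_star_dotProduct, toEuclideanLin] using h1
    have h3 := (hM.dotProduct_mulVec_zero_iff _).1 h2
    ext i
    simpa [toEuclideanLin] using congrFun h3 i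
  · intro h
    simp [quadForm, h]

/-- The quadratic form, as a real-linear functional of the matrix. -/
noncomputable def quadFormₗ (v : EuclideanSpace ℂ (Fin q)) : Matrix (Fin q) (Fin q) ℂ →ₗ[ℝ] ℝ where
  toFun M := quadForm M v
  map_add' A B := by simp [quadForm]
  map_smul' c A := by
    have : toEuclideanLin (c • A) v = c • toEuclideanLin A v := by
      ext i; simp [toEuclideanLin, smul_mulVec]
    rw [quadForm, this, ← Complex.coe_smul, inner_smul_right, Complex.re_ofReal_mul]
    rfl

theorem quadForm_projMatrix_mul_mul (U : Submodule ℂ (EuclideanSpace ℂ (Fin q)))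
    (M : Matrix (Fin q) (Fin q) ℂ) (v : EuclideanSpace ℂ (Fin q)) :
    quadForm (projMatrix U * M * projMatrix U) v = quadForm M (U.starProjection v) := by
  rw [quadForm, toEuclideanLin_mul_apply, toEuclideanLin_mul_apply,
    ← inner_toEuclideanLin_conjTranspose, (isHermitian_projMatrix U).eq,
    toEuclideanLin_projMatrix]
  rfl

theorem posSemidef_projMatrix_mul_mul_iff (U : Submodule ℂ (EuclideanSpace ℂ (Fin q)))
    {M : Matrix (Fin q) (Fin q) ℂ} (hM : M.IsHermitian) :
    (projMatrix U * M * projMatrix U).PosSemidef ↔ ∀ v ∈ U, 0 ≤ quadForm M v := by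
  constructor
  · intro h v hv
    have := quadForm_nonneg h v
    rwa [quadForm_projMatrix_mul_mul, Submodule.starProjection_eq_self_iff.2 hv] at this
  · intro h
    have hP := isHermitian_projMatrix U
    refine posSemidef_of_quadForm_nonneg ?_ fun v => ?_
    · have := isHermitian_mul_mul_conjTranspose (projMatrix U) hM
      rwa [hP.eq] at this
    · rw [quadForm_projMatrix_mul_mul]
      exact h _ (Submodule.starProjection_apply_mem U v)

/-- The vectors `P M P v` and `P^⊥ v` lie in `U` and its orthogonal complement, so a vanishing sum
kills both; positivity then turns the kernel condition into a vanishing quadratic form. -/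
theorem mem_ker_compress_iff (U : Submodule ℂ (EuclideanSpace ℂ (Fin q)))
    {M : Matrix (Fin q) (Fin q) ℂ} (hM : (projMatrix U * M * projMatrix U).PosSemidef)
    (v : EuclideanSpace ℂ (Fin q)) :
    v ∈ LinearMap.ker (toEuclideanLin (compress U M)) ↔ v ∈ U ∧ quadForm M v = 0 := by
  have key : ∀ v ∈ U, (toEuclideanLin (projMatrix U * M * projMatrix U) v = 0 ↔
      quadForm M v = 0) := by
    intro v hv
    rw [← quadForm_eq_zero_iff hM, quadForm_projMatrix_mul_mul,
      Submodule.starProjection_eq_self_iff.2 hv]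
  have e : toEuclideanLin (compress U M) v =
      toEuclideanLin (projMatrix U * M * projMatrix U) v + (v - U.starProjection v) := by
    rw [compress, map_add, map_sub, LinearMap.add_apply, LinearMap.sub_apply,
      toEuclideanLin_one_apply, toEuclideanLin_projMatrix]
  rw [LinearMap.mem_ker, e]
  constructor
  · intro h
    have hmem : toEuclideanLin (projMatrix U * M * projMatrix U) v ∈ U := by
      rw [mul_assoc, toEuclideanLin_mul_apply, toEuclideanLin_projMatrix]
      exact Submodule.starProjection_apply_mem U _
    have h1 : v - U.starProjection v ∈ U := by
      have : v - U.starProjection v = -toEuclideanLin (projMatrix U * M * projMatrix U) v :=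
        (neg_eq_of_add_eq_zero_right h).symm
      rw [this]; exact U.neg_mem hmem
    have hv : v ∈ U := by
      have := U.add_mem h1 (Submodule.starProjection_apply_mem U v)
      simpa using this
    refine ⟨hv, (key v hv).1 ?_⟩
    rwa [Submodule.starProjection_eq_self_iff.2 hv, sub_self, add_zero] at h
  · rintro ⟨hv, h⟩
    rw [(key v hv).2 h, Submodule.starProjection_eq_self_iff.2 hv, sub_self, add_zero]

theorem det_eq_zero_iff_ker_ne_bot (A : Matrix (Fin q) (Fin q) ℂ) :
    A.det = 0 ↔ LinearMap.ker (toEuclideanLin A) ≠ ⊥ := by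
  rw [← exists_mulVec_eq_zero_iff, Submodule.ne_bot_iff]
  constructor
  · rintro ⟨v, hv, h⟩
    refine ⟨WithLp.toLp 2 v, ?_, fun h0 => hv ?_⟩
    · ext i
      simpa [toEuclideanLin] using congrFun h i
    · simpa using congrArg WithLp.ofLp h0
  · rintro ⟨v, hv, h⟩
    refine ⟨v.ofLp, fun h0 => h (by ext i; simpa using congrFun h0 i), ?_⟩
    simpa [toEuclideanLin] using congrArg WithLp.ofLp (LinearMap.mem_ker.1 hv)

theorem mem_range_iff_of_isHermitian {A : Matrix (Fin q) (Fin q) ℂ} (hA : A.IsHermitian)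
    (v : EuclideanSpace ℂ (Fin q)) :
    v ∈ LinearMap.range (toEuclideanLin A) ↔ ∀ u, toEuclideanLin A u = 0 → inner ℂ u v = 0 := by
  have h : (LinearMap.ker (toEuclideanLin A))ᗮ = LinearMap.range (toEuclideanLin A) := by
    rw [LinearMap.orthogonal_ker, ← toEuclideanLin_conjTranspose_eq_adjoint, hA.eq]
  rw [← h, Submodule.mem_orthogonal]
  rfl

theorem quadForm_vecMulVec (v u : EuclideanSpace ℂ (Fin q)) :
    quadForm (vecMulVec v.ofLp (star v.ofLp)) u = ‖inner ℂ v u‖ ^ 2 := by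
  have : toEuclideanLin (vecMulVec v.ofLp (star v.ofLp)) u = (inner ℂ v u) • v := by
    ext i
    simp [toEuclideanLin, vecMulVec_mulVec, EuclideanSpace.inner_eq_star_dotProduct,
      dotProduct_comm, mul_comm]
  rw [quadForm, this, inner_smul_right, ← inner_conj_symm u v, Complex.mul_conj,
    Complex.normSq_eq_norm_sq, Complex.ofReal_re]

theorem matrixInner_vecMulVec {M : Matrix (Fin q) (Fin q) ℂ} (hM : M.IsHermitian)
    (v : EuclideanSpace ℂ (Fin q)) :
    matrixInner M (vecMulVec v.ofLp (star v.ofLp)) = quadForm M v := by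
  rw [matrixInner, hM.eq, mul_vecMulVec, trace_vecMulVec, quadForm,
    EuclideanSpace.inner_eq_star_dotProduct]
  rfl

/-- If `u` is in the kernel, both nonnegative summands of the quadratic form vanish at `u`, so `u ⊥
v`; the range is the orthogonal complement of the kernel. -/
theorem mem_range_add_smul_vecMulVec {A : Matrix (Fin q) (Fin q) ℂ} (hA : A.PosSemidef) {c : ℝ}
    (hc : 0 < c) (v : EuclideanSpace ℂ (Fin q)) :
    v ∈ LinearMap.range (toEuclideanLin (A + c • vecMulVec v.ofLp (star v.ofLp))) := by
  have hV : (vecMulVec v.ofLp (star v.ofLp)).PosSemidef := posSemidef_vecMulVec_self_star _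
  have hS : (A + c • vecMulVec v.ofLp (star v.ofLp)).PosSemidef := hA.add (hV.smul hc.le)
  refine (mem_range_iff_of_isHermitian hS.1 v).2 fun u hu => ?_
  have h1 := (quadForm_eq_zero_iff hS u).2 hu
  have h2 : quadForm (A + c • vecMulVec v.ofLp (star v.ofLp)) u
      = quadForm A u + c * quadForm (vecMulVec v.ofLp (star v.ofLp)) u := by
    change quadFormₗ u _ = quadFormₗ u _ + c * quadFormₗ u _
    rw [map_add, map_smul, smul_eq_mul]
  rw [h2, quadForm_vecMulVec] at h1
  have h3 := quadForm_nonneg hA u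
  have h4 : ‖inner ℂ v u‖ ^ 2 = 0 := by
    by_contra h
    have : 0 < c * ‖inner ℂ v u‖ ^ 2 := mul_pos hc (lt_of_le_of_ne (by positivity) (Ne.symm h))
    linarith
  rw [← inner_conj_symm, norm_eq_zero.1 (pow_eq_zero_iff two_ne_zero |>.1 h4), map_zero]

open scoped MatrixOrder Matrix.Norms.L2Operator in
/-- A positive semidefinite matrix is a sum of rank one matrices `w wᴴ`. -/
theorem exists_matrixInner_eq_sum_quadForm {Φ : Matrix (Fin q) (Fin q) ℂ} (hΦ : Φ.PosSemidef) :
    ∃ w : Fin q → EuclideanSpace ℂ (Fin q),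
      (∀ M : Matrix (Fin q) (Fin q) ℂ, M.IsHermitian →
        matrixInner M Φ = ∑ i, quadForm M (w i)) ∧
      ∀ U : Submodule ℂ (EuclideanSpace ℂ (Fin q)),
        LinearMap.range (toEuclideanLin Φ) ≤ U ↔ ∀ i, w i ∈ U := by
  obtain ⟨B, hB⟩ := CStarAlgebra.nonneg_iff_eq_star_mul_self.1 hΦ.nonneg
  -- With `Φ = Bᴴ B`, the vectors `w i` are the conjugated rows of `B`.
  let w : Fin q → EuclideanSpace ℂ (Fin q) := fun i => WithLp.toLp 2 (star (B i))
  have hsum : Φ = ∑ i, vecMulVec (w i).ofLp (star (w i).ofLp) := by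
    ext a b
    simp [hB, w, mul_apply, Matrix.sum_apply, vecMulVec_apply]
  refine ⟨w, fun M hM => ?_, fun U => ⟨fun h i => ?_, ?_⟩⟩
  · calc matrixInner M Φ = ∑ i, matrixInner M (vecMulVec (w i).ofLp (star (w i).ofLp)) := by
          rw [hsum]; simp [matrixInner, Finset.mul_sum, trace_sum]
      _ = _ := Finset.sum_congr rfl fun i _ => matrixInner_vecMulVec hM _
  · refine h ((mem_range_iff_of_isHermitian hΦ.1 _).2 fun u hu => ?_)
    have h1 := (quadForm_eq_zero_iff hΦ u).2 hu
    have h2 : quadForm Φ u = ∑ i, ‖inner ℂ (w i) u‖ ^ 2 := by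
      conv_lhs => rw [hsum]
      change quadFormₗ u _ = _
      rw [map_sum]
      exact Finset.sum_congr rfl fun i _ => quadForm_vecMulVec _ _
    rw [h2, Finset.sum_eq_zero_iff_of_nonneg fun i _ => by positivity] at h1
    have h3 := h1 i (Finset.mem_univ i)
    rw [← inner_conj_symm, norm_eq_zero.1 (pow_eq_zero_iff two_ne_zero |>.1 h3), map_zero]
  · rintro h _ ⟨u, rfl⟩
    have : toEuclideanLin Φ u = ∑ i, (inner ℂ (w i) u) • w i := by
      conv_lhs => rw [hsum]
      rw [map_sum, LinearMap.sum_apply]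
      refine Finset.sum_congr rfl fun i _ => ?_
      ext j
      simp [toEuclideanLin, vecMulVec_mulVec, EuclideanSpace.inner_eq_star_dotProduct,
        dotProduct_comm, mul_comm]
    rw [this]
    exact U.sum_mem fun i _ => U.smul_mem _ (h i)

end QuadForm

/-! ### Relative interiors of finite-dimensional convex cones. -/

/-- A point of a finite-dimensional space at which no functional that is nonnegative on a spanning
cone is nonpositive lies in the interior of the cone. -/
theorem PointedCone.mem_interior_of_forall_eq_zero {V : Type*} [NormedAddCommGroup V]
    [NormedSpace ℝ V] [FiniteDimensional ℝ V] (K : PointedCone ℝ V)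
    (hspan : Submodule.span ℝ (K : Set V) = ⊤) (a : V)
    (h : ∀ f : V →ₗ[ℝ] ℝ, (∀ k ∈ K, 0 ≤ f k) → f a ≤ 0 → f = 0) :
    a ∈ interior (K : Set V) := by
  have hconv : Convex ℝ (K : Set V) := K.convex
  have hne : (interior (K : Set V)).Nonempty := by
    rw [hconv.interior_nonempty_iff_affineSpan_eq_top,
      AffineSubspace.affineSpan_eq_top_iff_vectorSpan_eq_top_of_nonempty ℝ V V ⟨0, K.zero_mem⟩,
      vectorSpan_eq_span_vsub_set_right ℝ K.zero_mem]
    simpa using hspan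
  by_contra hmem
  obtain ⟨f, hf⟩ := geometric_hahn_banach_open_point hconv.interior isOpen_interior hmem
  have hle : ∀ k ∈ K, f k ≤ f a := by
    intro k hk
    have hcl : k ∈ closure (interior (K : Set V)) := by
      rw [hconv.closure_interior_eq_closure_of_nonempty_interior hne]
      exact subset_closure hk
    exact closure_minimal (fun b hb => (hf b hb).le) (isClosed_le f.continuous continuous_const) hcl
  have hK : ∀ k ∈ K, f k ≤ 0 := by
    intro k hk
    by_contra! hpos
    have h0 : 0 ≤ f a := by simpa using hle 0 K.zero_mem
    -- A functional bounded above on a cone is nonpositive there: this multiple of `k` would have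
    -- value `f a + 1`.
    have ht : 0 ≤ (f a + 1) / f k := by positivity
    have h1 := hle _ (K.smul_mem ht hk)
    rw [map_smul, smul_eq_mul, div_mul_cancel₀ _ hpos.ne'] at h1
    linarith
  have hz := h (-f.toLinearMap) (fun k hk => by simpa using hK k hk)
    (by simpa using hle 0 K.zero_mem)
  obtain ⟨b, hb⟩ := hne
  have h3 := hf b hb
  have h4 : ∀ v, f v = 0 := fun v => by simpa using LinearMap.congr_fun hz v
  rw [h4, h4] at h3
  exact lt_irrefl _ h3

theorem PointedCone.exists_sub_smul_mem_hull_of_spanning {V : Type*} [AddCommGroup V] [Module ℝ V]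
    [FiniteDimensional ℝ V] (S : Set V) (hspan : Submodule.span ℝ S = ⊤) (a : V)
    (h : ∀ f : V →ₗ[ℝ] ℝ, (∀ s ∈ S, 0 ≤ f s) → f a ≤ 0 → f = 0) (s : V) :
    ∃ ε : ℝ, 0 < ε ∧ a - ε • s ∈ PointedCone.hull ℝ S := by
  -- `V` carries no topology, so a norm is pulled back from coordinates.
  let e := (Module.finBasis ℝ V).equivFun
  let _ : NormedAddCommGroup V := NormedAddCommGroup.induced V _ e e.injective
  let _ : NormedSpace ℝ V := NormedSpace.induced ℝ V _ e
  have hint := (PointedCone.hull ℝ S).mem_interior_of_forall_eq_zero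
    (top_unique (hspan ▸ Submodule.span_mono PointedCone.subset_hull)) a
    fun f hf => h f fun t ht => hf t (PointedCone.subset_hull ht)
  have hcont : Continuous fun ε : ℝ => a - ε • s := by fun_prop
  have hev : ∀ᶠ ε in nhds (0 : ℝ), a - ε • s ∈ (PointedCone.hull ℝ S : Set V) :=
    hcont.continuousAt.eventually_mem (by simpa using mem_interior_iff_mem_nhds.1 hint)
  obtain ⟨ε, h1, h2⟩ := ((hev.filter_mono nhdsWithin_le_nhds).and
    (self_mem_nhdsWithin (s := Set.Ioi (0 : ℝ)))).exists
  exact ⟨ε, h2, h1⟩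

/-- A point at which every functional that is nonnegative on `S` is nonnegative, and vanishes only
if it vanishes on `S`, lies in the relative interior of the cone generated by `S`. -/
theorem PointedCone.exists_sub_smul_mem_hull {V : Type*} [AddCommGroup V] [Module ℝ V]
    [FiniteDimensional ℝ V] (S : Set V) (a : V)
    (h : ∀ f : V →ₗ[ℝ] ℝ, (∀ s ∈ S, 0 ≤ f s) → f a ≤ 0 → f a = 0 ∧ ∀ s ∈ S, f s = 0)
    {s : V} (hs : s ∈ S) :
    ∃ ε : ℝ, 0 < ε ∧ a - ε • s ∈ PointedCone.hull ℝ S := by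
  set L := Submodule.span ℝ S with hL
  -- A functional vanishing on `S` but not at `a` would, up to sign, violate `h`.
  have ha : a ∈ L := by
    by_contra hmem
    obtain ⟨f, hfa, hfL⟩ := Submodule.exists_le_ker_of_notMem hmem
    have hf : ∀ s ∈ S, f s = 0 := fun s hs => hfL (Submodule.subset_span hs)
    rcases le_total (f a) 0 with h0 | h0
    · exact hfa (h f (fun s hs => (hf s hs).ge) h0).1
    · have := (h (-f) (fun s hs => by simp [hf s hs]) (by simpa using h0)).1
      exact hfa (by simpa using this)
  let S' : Set L := L.subtype ⁻¹' S
  have hS' : Submodule.span ℝ S' = ⊤ := Submodule.span_span_coe_preimage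
  obtain ⟨ε, hε, hmem⟩ := PointedCone.exists_sub_smul_mem_hull_of_spanning S' hS' ⟨a, ha⟩
    (fun f hf hfa => by
      obtain ⟨g, rfl⟩ := f.exists_extend
      have hg := (h g (fun s hs => hf ⟨s, Submodule.subset_span hs⟩ hs) hfa).2
      exact LinearMap.ext_on hS' fun s hs => hg _ hs)
    ⟨s, Submodule.subset_span hs⟩
  refine ⟨ε, hε, ?_⟩
  have hle : ∀ t ∈ PointedCone.hull ℝ S', (t : V) ∈ PointedCone.hull ℝ S := fun t ht =>
    Submodule.span_induction (p := fun (t : L) _ => (t : V) ∈ PointedCone.hull ℝ S)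
      (fun t ht => PointedCone.subset_hull ht) (Submodule.zero_mem _)
      (fun _ _ _ _ h1 h2 => Submodule.add_mem _ h1 h2)
      (fun c _ _ h1 => Submodule.smul_mem _ c h1) ht
  exact hle _ hmem

/-- By reflexivity the functionals on the dual are evaluations at elements `F` of `W`. -/
theorem Module.Dual.exists_sub_smul_mem_hull {W : Type*} [AddCommGroup W] [Module ℝ W]
    [FiniteDimensional ℝ W] (S : Set (Module.Dual ℝ W)) (a : Module.Dual ℝ W)
    (h : ∀ F : W, (∀ s ∈ S, 0 ≤ s F) → a F ≤ 0 → a F = 0 ∧ ∀ s ∈ S, s F = 0)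
    {s : Module.Dual ℝ W} (hs : s ∈ S) :
    ∃ ε : ℝ, 0 < ε ∧ a - ε • s ∈ PointedCone.hull ℝ S := by
  refine PointedCone.exists_sub_smul_mem_hull S a (fun f => ?_) hs
  obtain ⟨F, rfl⟩ := (Module.evalEquiv ℝ W).surjective f
  exact h F

/-! ### Measurable matrix-valued maps. -/

namespace MatrixMeasurable

variable {X : Type*} [MeasurableSpace X] {q : ℕ} {F G : X → Matrix (Fin q) (Fin q) ℂ}

theorem const (M : Matrix (Fin q) (Fin q) ℂ) : MatrixMeasurable fun _ : X => M :=
  fun _ _ => measurable_const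

theorem add (hF : MatrixMeasurable F) (hG : MatrixMeasurable G) :
    MatrixMeasurable fun x => F x + G x :=
  fun i j => (hF i j).add (hG i j)

theorem sub (hF : MatrixMeasurable F) (hG : MatrixMeasurable G) :
    MatrixMeasurable fun x => F x - G x :=
  fun i j => (hF i j).sub (hG i j)

theorem mul (hF : MatrixMeasurable F) (hG : MatrixMeasurable G) :
    MatrixMeasurable fun x => F x * G x := fun i j => by
  simp only [mul_apply]
  exact Finset.measurable_fun_sum _ fun k _ => (hF i k).mul (hG k j)

theorem conjTranspose (hF : MatrixMeasurable F) : MatrixMeasurable fun x => (F x)ᴴ :=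
  fun i j => Complex.continuous_conj.measurable.comp (hF j i)

theorem pow (hF : MatrixMeasurable F) (n : ℕ) : MatrixMeasurable fun x => F x ^ n := by
  induction n with
  | zero => simpa using const 1
  | succ n ih => simpa only [pow_succ] using ih.mul hF

theorem det (hF : MatrixMeasurable F) : Measurable fun x => (F x).det := by
  simp only [det_apply]
  exact Finset.measurable_fun_sum _ fun σ _ =>
    (Finset.measurable_fun_prod _ fun i _ => hF (σ i) i).const_smul _

theorem inv (hF : MatrixMeasurable F) : MatrixMeasurable fun x => (F x)⁻¹ := fun i j => by
  -- Cramer's rule; for a singular matrix both sides are `0` by convention.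
  have h : ∀ x, (F x)⁻¹ i j = (F x).det⁻¹ * ((F x).updateRow j (Pi.single i 1)).det := fun x => by
    rw [inv_def, Matrix.smul_apply, Ring.inverse_eq_inv', smul_eq_mul, adjugate_apply]
  simp only [h]
  refine hF.det.inv.mul (det fun k l => ?_)
  by_cases h : k = j
  · subst h
    simp only [updateRow_self, measurable_const]
  · simpa only [updateRow_ne h] using hF k l

end MatrixMeasurable

/-! ### Measurable dependence of kernel projections on the matrix. -/

section Projection

variable {q : ℕ}

/-- For `w = (1 + Aᴴ A)⁻¹ v`, pairing `v = w + Aᴴ A w` with `w` gives `‖w‖² ≤ Re ⟪w, v⟫`. -/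
theorem norm_toEuclideanLin_inv_one_add_le (A : Matrix (Fin q) (Fin q) ℂ)
    (v : EuclideanSpace ℂ (Fin q)) : ‖toEuclideanLin (1 + Aᴴ * A)⁻¹ v‖ ≤ ‖v‖ := by
  have hB : (1 + Aᴴ * A).PosDef := PosDef.one.add_posSemidef (posSemidef_conjTranspose_mul_self A)
  have hdet : IsUnit (1 + Aᴴ * A).det := (isUnit_iff_isUnit_det _).1 hB.isUnit
  set w := toEuclideanLin (1 + Aᴴ * A)⁻¹ v with hw
  have hv : v = w + toEuclideanLin (Aᴴ * A) w := by
    have : toEuclideanLin (1 + Aᴴ * A) w = v := by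
      rw [hw, ← toEuclideanLin_mul_apply, mul_nonsing_inv _ hdet, toEuclideanLin_one_apply]
    rw [← this, map_add, LinearMap.add_apply, toEuclideanLin_one_apply]
  have h1 : ‖w‖ ^ 2 ≤ ‖w‖ * ‖v‖ := by
    have h2 : (inner ℂ w v).re = ‖w‖ ^ 2 + quadForm (Aᴴ * A) w := by
      conv_lhs => rw [hv]
      rw [inner_add_right, Complex.add_re, quadForm]
      congr 1
      exact inner_self_eq_norm_sq (𝕜 := ℂ) w
    have h3 := quadForm_nonneg (posSemidef_conjTranspose_mul_self A) w
    have h4 : (inner ℂ w v).re ≤ ‖w‖ * ‖v‖ := re_inner_le_norm (𝕜 := ℂ) w v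
    linarith
  rcases (norm_nonneg w).eq_or_lt with h0 | h0
  · rw [← h0]; exact norm_nonneg v
  · rw [sq] at h1
    exact le_of_mul_le_mul_left h1 h0

theorem toEuclideanLin_inv_one_add_eq_self_iff (A : Matrix (Fin q) (Fin q) ℂ)
    (v : EuclideanSpace ℂ (Fin q)) :
    toEuclideanLin (1 + Aᴴ * A)⁻¹ v = v ↔ toEuclideanLin A v = 0 := by
  have hB : (1 + Aᴴ * A).PosDef := PosDef.one.add_posSemidef (posSemidef_conjTranspose_mul_self A)
  have hdet : IsUnit (1 + Aᴴ * A).det := (isUnit_iff_isUnit_det _).1 hB.isUnit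
  have hadd : toEuclideanLin (1 + Aᴴ * A) v = v + toEuclideanLin (Aᴴ * A) v := by
    rw [map_add, LinearMap.add_apply, toEuclideanLin_one_apply]
  constructor
  · intro h
    have h1 : toEuclideanLin (1 + Aᴴ * A) v = v := by
      conv_lhs => rw [← h]
      rw [← toEuclideanLin_mul_apply, mul_nonsing_inv _ hdet, toEuclideanLin_one_apply]
    have h2 : toEuclideanLin (Aᴴ * A) v = 0 := by rwa [hadd, add_eq_left] at h1
    have h3 : inner ℂ (toEuclideanLin A v) (toEuclideanLin A v) = 0 := by
      have := inner_toEuclideanLin_conjTranspose A (toEuclideanLin A v) v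
      rw [← this, ← toEuclideanLin_mul_apply, h2, inner_zero_left]
    exact inner_self_eq_zero.1 h3
  · intro h
    have h1 : toEuclideanLin (1 + Aᴴ * A) v = v := by
      rw [hadd, toEuclideanLin_mul_apply, h, map_zero, add_zero]
    conv_lhs => rw [← h1]
    rw [← toEuclideanLin_mul_apply, nonsing_inv_mul _ hdet, toEuclideanLin_one_apply]

theorem toEuclideanLin_single_apply (M : Matrix (Fin q) (Fin q) ℂ) (i j : Fin q) :
    toEuclideanLin M (EuclideanSpace.single j 1) i = M i j := by
  simp [toEuclideanLin]

/-- The projection onto a kernel is a limit of Cesàro means of powers of a resolvent. -/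
theorem tendsto_sum_pow_projMatrix_ker (A : Matrix (Fin q) (Fin q) ℂ) (i j : Fin q) :
    Filter.Tendsto
      (fun n : ℕ => (n : ℂ)⁻¹ * ∑ k ∈ Finset.range n, ((1 + Aᴴ * A)⁻¹ ^ k : Matrix _ _ ℂ) i j)
      Filter.atTop (nhds (projMatrix (LinearMap.ker (toEuclideanLin A)) i j)) := by
  set R := (1 + Aᴴ * A)⁻¹ with hR
  let f : EuclideanSpace ℂ (Fin q) →L[ℂ] EuclideanSpace ℂ (Fin q) :=
    toEuclideanCLM (n := Fin q) (𝕜 := ℂ) R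
  have hf : ‖f‖ ≤ 1 := f.opNorm_le_bound zero_le_one fun v => by
    rw [one_mul]; exact norm_toEuclideanLin_inv_one_add_le A v
  have hloc : f.eqLocus (1 : EuclideanSpace ℂ (Fin q) →L[ℂ] EuclideanSpace ℂ (Fin q))
      = LinearMap.ker (toEuclideanLin A) := by
    ext v
    exact toEuclideanLin_inv_one_add_eq_self_iff A v
  have hlim := f.tendsto_birkhoffAverage_orthogonalProjection hf (EuclideanSpace.single j 1)
  -- `hlim` is von Neumann's mean ergodic theorem for the contraction `f`, whose fixed space is `ker
  -- A`; it remains to read it off in matrix entries.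
  have hpow : ∀ k, f^[k] (EuclideanSpace.single j 1)
      = toEuclideanLin (R ^ k) (EuclideanSpace.single j 1) := by
    intro k
    induction k with
    | zero => rw [pow_zero, toEuclideanLin_one_apply]; rfl
    | succ k ih =>
      rw [Function.iterate_succ_apply', ih, pow_succ', toEuclideanLin_mul_apply]; rfl
  have hc : Continuous fun v : EuclideanSpace ℂ (Fin q) => v i := by fun_prop
  have h2 := (hc.tendsto _).comp hlim
  have h3 : (((f.eqLocus (1 : EuclideanSpace ℂ (Fin q) →L[ℂ] EuclideanSpace ℂ (Fin q))
      ).orthogonalProjectionOnto (EuclideanSpace.single j 1) : EuclideanSpace ℂ (Fin q))) i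
      = projMatrix (LinearMap.ker (toEuclideanLin A)) i j := by
    refine Eq.trans ?_ (toEuclideanLin_single_apply _ i j)
    rw [toEuclideanLin_projMatrix, ← hloc]
    rfl
  rw [h3] at h2
  refine h2.congr fun n => ?_
  simp only [Function.comp_apply, birkhoffAverage, birkhoffSum, id_eq, hpow, PiLp.smul_apply,
    smul_eq_mul]
  congr 1
  rw [WithLp.ofLp_sum, Finset.sum_apply]
  exact Finset.sum_congr rfl fun k _ => toEuclideanLin_single_apply _ i j

theorem MatrixMeasurable.projMatrix_ker {X : Type*} [MeasurableSpace X]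
    {A : X → Matrix (Fin q) (Fin q) ℂ} (hA : MatrixMeasurable A) :
    MatrixMeasurable fun x => projMatrix (LinearMap.ker (toEuclideanLin (A x))) := fun i j => by
  have hR : MatrixMeasurable fun x => (1 + (A x)ᴴ * A x)⁻¹ :=
    ((MatrixMeasurable.const 1).add (hA.conjTranspose.mul hA)).inv
  exact measurable_of_tendsto_metrizable
    (fun n : ℕ => (Finset.measurable_fun_sum (Finset.range n)
      fun k _ => hR.pow k i j).const_mul ((n : ℂ)⁻¹))
    (tendsto_pi_nhds.2 fun x => tendsto_sum_pow_projMatrix_ker (A x) i j)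

end Projection

/-! ### The core recursion: reformulation, termination and measurability. -/

section CoreStage

variable {X : Type*} {q : ℕ}
  {E : Submodule ℝ (X → Matrix (Fin q) (Fin q) ℂ)}

/-- The functional `F ↦ ⟪v, F(x) v⟫` on `E`. -/
noncomputable def pointFunctional (E : Submodule ℝ (X → Matrix (Fin q) (Fin q) ℂ)) (x : X)
    (v : EuclideanSpace ℂ (Fin q)) : Module.Dual ℝ E :=
  quadFormₗ v ∘ₗ LinearMap.proj x ∘ₗ E.subtype

theorem mem_coreCone_iff (hE : ∀ F ∈ E, ∀ x, (F x).IsHermitian) (Λ : E →ₗ[ℝ] ℝ) {S : Set X}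
    {U : X → Submodule ℂ (EuclideanSpace ℂ (Fin q))} (hSU : ∀ x, x ∉ S → U x = ⊥) (F : E) :
    F ∈ coreCone Λ S U ↔ Λ F = 0 ∧ ∀ x, ∀ v ∈ U x, 0 ≤ pointFunctional E x v F := by
  refine and_congr_right fun _ => ⟨fun h x v hv => ?_, fun h x _ =>
    (posSemidef_projMatrix_mul_mul_iff _ (hE F F.2 x)).2 (h x)⟩
  by_cases hx : x ∈ S
  · exact (posSemidef_projMatrix_mul_mul_iff _ (hE F F.2 x)).1 (h x hx) v hv
  · rw [hSU x hx, Submodule.mem_bot] at hv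
    rw [hv]
    simp [pointFunctional, quadFormₗ, quadForm]

theorem coreStage_succ_le (Λ : E →ₗ[ℝ] ℝ) (j : ℕ) (x : X) :
    (coreStage Λ (j + 1)).2 x ≤ (coreStage Λ j).2 x := by
  intro v hv
  -- For `F = 0` the compressed matrix is `P^⊥`, whose kernel is the old subspace.
  have h0 : (0 : E) ∈ coreCone Λ (coreStage Λ j).1 (coreStage Λ j).2 :=
    ⟨map_zero Λ, fun x _ => by simpa using PosSemidef.zero⟩
  have h1 := (Submodule.mem_iInf _).1 ((Submodule.mem_iInf _).1 hv 0) h0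
  exact ((mem_ker_compress_iff _ (by simpa using PosSemidef.zero) v).1 h1).1

theorem coreStage_antitone (Λ : E →ₗ[ℝ] ℝ) (x : X) : Antitone fun j => (coreStage Λ j).2 x :=
  antitone_nat_of_succ_le fun j => coreStage_succ_le Λ j x

/-- Off the set of a stage its subspace is trivial, so positivity conditions may be imposed at all
points and the sets dropped from the recursion. -/
theorem coreStage_eq_bot (Λ : E →ₗ[ℝ] ℝ) (j : ℕ) : ∀ x, x ∉ (coreStage Λ j).1 →
    (coreStage Λ j).2 x = ⊥ := by
  induction j with
  | zero => exact fun x hx => absurd (Set.mem_univ x) hx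
  | succ j ih =>
    intro x hx
    by_cases hxj : x ∈ (coreStage Λ j).1
    · have h : ∃ F ∈ coreCone Λ (coreStage Λ j).1 (coreStage Λ j).2,
          (compress ((coreStage Λ j).2 x) ((F : X → Matrix (Fin q) (Fin q) ℂ) x)).det ≠ 0 := by
        by_contra! h
        exact hx ⟨hxj, h⟩
      obtain ⟨F, hF, hdet⟩ := h
      have hker := not_not.1 (mt (det_eq_zero_iff_ker_ne_bot _).2 hdet)
      exact eq_bot_iff.2 ((iInf₂_le F hF).trans hker.le)
    · exact eq_bot_iff.2 ((coreStage_succ_le Λ j x).trans (ih x hxj).le)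

theorem mem_coreCone_coreStage_iff (hE : ∀ F ∈ E, ∀ x, (F x).IsHermitian) (Λ : E →ₗ[ℝ] ℝ) (j : ℕ)
    (F : E) : F ∈ coreCone Λ (coreStage Λ j).1 (coreStage Λ j).2 ↔
      Λ F = 0 ∧ ∀ x, ∀ v ∈ (coreStage Λ j).2 x, 0 ≤ pointFunctional E x v F :=
  mem_coreCone_iff hE Λ (coreStage_eq_bot Λ j) F

theorem mem_ker_compress_coreStage_iff (hE : ∀ F ∈ E, ∀ x, (F x).IsHermitian) (Λ : E →ₗ[ℝ] ℝ)
    (j : ℕ) {F : E} (hF : F ∈ coreCone Λ (coreStage Λ j).1 (coreStage Λ j).2) (x : X)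
    (v : EuclideanSpace ℂ (Fin q)) :
    v ∈ LinearMap.ker (toEuclideanLin (compress ((coreStage Λ j).2 x)
      ((F : X → Matrix (Fin q) (Fin q) ℂ) x))) ↔
      v ∈ (coreStage Λ j).2 x ∧ pointFunctional E x v F = 0 :=
  mem_ker_compress_iff _ ((posSemidef_projMatrix_mul_mul_iff _ (hE F F.2 x)).2
    (((mem_coreCone_coreStage_iff hE Λ j F).1 hF).2 x)) v

theorem mem_coreStage_succ_iff (hE : ∀ F ∈ E, ∀ x, (F x).IsHermitian) (Λ : E →ₗ[ℝ] ℝ) (j : ℕ)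
    (x : X) (v : EuclideanSpace ℂ (Fin q)) :
    v ∈ (coreStage Λ (j + 1)).2 x ↔ v ∈ (coreStage Λ j).2 x ∧
      ∀ F ∈ coreCone Λ (coreStage Λ j).1 (coreStage Λ j).2, pointFunctional E x v F = 0 := by
  constructor
  · intro hv
    refine ⟨coreStage_succ_le Λ j x hv, fun F hF => ?_⟩
    exact ((mem_ker_compress_coreStage_iff hE Λ j hF x v).1
      ((Submodule.mem_iInf _).1 ((Submodule.mem_iInf _).1 hv F) hF)).2
  · rintro ⟨hv, h⟩
    exact (Submodule.mem_iInf _).2 fun F => (Submodule.mem_iInf _).2 fun hF =>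
      (mem_ker_compress_coreStage_iff hE Λ j hF x v).2 ⟨hv, h F hF⟩

theorem coreCone_coreStage_mono (hE : ∀ F ∈ E, ∀ x, (F x).IsHermitian) (Λ : E →ₗ[ℝ] ℝ) :
    Monotone fun j => coreCone Λ (coreStage Λ j).1 (coreStage Λ j).2 := by
  refine monotone_nat_of_le_succ fun j F hF => ?_
  rw [mem_coreCone_coreStage_iff hE] at hF ⊢
  exact ⟨hF.1, fun x v hv => hF.2 x v (coreStage_succ_le Λ j x hv)⟩

variable [FiniteDimensional ℝ E]

/-- Vanishing on the cone is a linear condition, so finitely many elements of the cone suffice to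
test it. -/
theorem exists_finset_span_coreCone (Λ : E →ₗ[ℝ] ℝ) (S : Set X)
    (U : X → Submodule ℂ (EuclideanSpace ℂ (Fin q))) :
    ∃ T : Finset E, (T : Set E) ⊆ coreCone Λ S U ∧
      coreCone Λ S U ⊆ Submodule.span ℝ (T : Set E) := by
  obtain ⟨T, hT, h⟩ := (Submodule.fg_span_iff_fg_span_finset_subset (coreCone Λ S U)).1
    (IsNoetherian.noetherian (Submodule.span ℝ (coreCone Λ S U)))
  exact ⟨T, hT, h ▸ Submodule.subset_span⟩

theorem eq_zero_of_mem_span {V : Type*} [AddCommGroup V] [Module ℝ V] {l : Module.Dual ℝ V}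
    {T : Set V} (h : ∀ F ∈ T, l F = 0) {F : V} (hF : F ∈ Submodule.span ℝ T) : l F = 0 :=
  (Submodule.span_le (p := LinearMap.ker l)).2 h hF

/-- The next subspace is the kernel attached to a single element of the cone. -/
theorem exists_coreStage_succ_eq_ker (hE : ∀ F ∈ E, ∀ x, (F x).IsHermitian) (Λ : E →ₗ[ℝ] ℝ)
    (j : ℕ) : ∃ F ∈ coreCone Λ (coreStage Λ j).1 (coreStage Λ j).2, ∀ x,
      (coreStage Λ (j + 1)).2 x = LinearMap.ker (toEuclideanLin
        (compress ((coreStage Λ j).2 x) ((F : X → Matrix (Fin q) (Fin q) ℂ) x))) := by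
  obtain ⟨T, hT, hspan⟩ := exists_finset_span_coreCone Λ (coreStage Λ j).1 (coreStage Λ j).2
  have hTnn : ∀ F ∈ T, ∀ x, ∀ v ∈ (coreStage Λ j).2 x, 0 ≤ pointFunctional E x v F :=
    fun F hF => ((mem_coreCone_coreStage_iff hE Λ j F).1 (hT hF)).2
  -- The sum of the finite spanning family serves as the single element: its terms are nonnegative
  -- at each `v` of the stage, so it vanishes there only if all of them do.
  have hmem : ∑ F ∈ T, F ∈ coreCone Λ (coreStage Λ j).1 (coreStage Λ j).2 := by
    rw [mem_coreCone_coreStage_iff hE]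
    refine ⟨?_, fun x v hv => ?_⟩
    · rw [map_sum]
      exact Finset.sum_eq_zero fun F hF => (hT hF).1
    · rw [map_sum]
      exact Finset.sum_nonneg fun F hF => hTnn F hF x v hv
  refine ⟨_, hmem, fun x => ?_⟩
  ext v
  rw [mem_ker_compress_coreStage_iff hE Λ j hmem, mem_coreStage_succ_iff hE]
  refine and_congr_right fun hv => ⟨fun h => h _ hmem, fun h F hF => ?_⟩
  rw [map_sum, Finset.sum_eq_zero_iff_of_nonneg fun F hF => hTnn F hF x v hv] at h
  exact eq_zero_of_mem_span h (hspan hF)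

/-- Singularity for each `F` separately need not give a common kernel vector; it does here because
one `F` computes the whole intersection. At stage `0` the condition is `ℂ^q ≠ 0`. -/
theorem mem_coreStage_fst_iff (hq : 0 < q) (hE : ∀ F ∈ E, ∀ x, (F x).IsHermitian)
    (Λ : E →ₗ[ℝ] ℝ) (j : ℕ) (x : X) :
    x ∈ (coreStage Λ j).1 ↔ (coreStage Λ j).2 x ≠ ⊥ := by
  refine ⟨fun hx => ?_, fun h => by_contra fun hx => h (coreStage_eq_bot Λ j x hx)⟩
  cases j with
  | zero =>
    have : Nonempty (Fin q) := ⟨⟨0, hq⟩⟩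
    exact top_ne_bot
  | succ j =>
    obtain ⟨F, hF, h⟩ := exists_coreStage_succ_eq_ker hE Λ j
    rw [h, ← det_eq_zero_iff_ker_ne_bot]
    exact hx.2 F hF

/-- The recursion is stationary after finitely many steps. -/
theorem exists_coreStage_stable (hE : ∀ F ∈ E, ∀ x, (F x).IsHermitian) (Λ : E →ₗ[ℝ] ℝ) :
    ∃ n, ∀ m, n ≤ m → ∀ x, (coreStage Λ m).2 x = (coreStage Λ n).2 x := by
  let N : ℕ → Set E := fun j => coreCone Λ (coreStage Λ j).1 (coreStage Λ j).2
  obtain ⟨n, hn⟩ := monotone_stabilizes_iff_noetherian.2 (inferInstance : IsNoetherian ℝ E)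
    ⟨fun j => Submodule.span ℝ (N j), fun i j hij =>
      Submodule.span_mono (coreCone_coreStage_mono hE Λ hij)⟩
  -- The spans of the cones are constant from `n` on. Stage `n + 1` is already annihilated by the
  -- cone of stage `n`, hence by all later ones.
  refine ⟨n + 1, fun m hm x => ?_⟩
  refine le_antisymm (coreStage_antitone Λ x hm) ?_
  induction m, hm using Nat.le_induction with
  | base => exact le_rfl
  | succ m hm ih =>
    intro v hv
    refine (mem_coreStage_succ_iff hE Λ m x v).2 ⟨ih hv, fun F hF => ?_⟩
    have h1 : F ∈ Submodule.span ℝ (N n) := by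
      have h2 : Submodule.span ℝ (N n) = Submodule.span ℝ (N m) := hn m (by omega)
      rw [h2]
      exact Submodule.subset_span hF
    exact eq_zero_of_mem_span ((mem_coreStage_succ_iff hE Λ n x v).1 hv).2 h1

/-- At the stationary stage no element of the cone cuts further; the last clause is what makes `Λ` a
relative interior point. -/
theorem exists_coreStage_eq_core (hq : 0 < q) (hE : ∀ F ∈ E, ∀ x, (F x).IsHermitian)
    (Λ : E →ₗ[ℝ] ℝ) : ∃ n, (∀ x, coreSpace Λ x = (coreStage Λ n).2 x) ∧
      (∀ x, x ∈ coreSet Λ ↔ coreSpace Λ x ≠ ⊥) ∧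
      ∀ F ∈ coreCone Λ (coreStage Λ n).1 (coreStage Λ n).2, ∀ x, ∀ v ∈ (coreStage Λ n).2 x,
        pointFunctional E x v F = 0 := by
  obtain ⟨n, hn⟩ := exists_coreStage_stable hE Λ
  have hle : ∀ j x, (coreStage Λ n).2 x ≤ (coreStage Λ j).2 x := fun j x => by
    rw [← hn (max n j) (le_max_left _ _) x]
    exact coreStage_antitone Λ x (le_max_right _ _)
  have hsp : ∀ x, coreSpace Λ x = (coreStage Λ n).2 x := fun x =>
    le_antisymm (iInf_le _ n) (le_iInf fun j => hle j x)
  refine ⟨n, hsp, fun x => ?_, fun F hF x v hv => ?_⟩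
  · rw [hsp, coreSet, Set.mem_iInter]
    refine ⟨fun h => (mem_coreStage_fst_iff hq hE Λ n x).1 (h n), fun h j => ?_⟩
    exact (mem_coreStage_fst_iff hq hE Λ j x).2 fun h0 => h (le_bot_iff.1 (h0 ▸ hle j x))
  · rw [← hn (n + 1) n.le_succ] at hv
    exact ((mem_coreStage_succ_iff hE Λ n x v).1 hv).2 F hF

theorem matrixMeasurable_projMatrix_coreStage [MeasurableSpace X]
    (hE : ∀ F ∈ E, MatrixMeasurable F ∧ ∀ x, (F x).IsHermitian) (Λ : E →ₗ[ℝ] ℝ) (j : ℕ) :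
    MatrixMeasurable fun x => projMatrix ((coreStage Λ j).2 x) := by
  induction j with
  | zero => exact MatrixMeasurable.const (projMatrix ⊤)
  | succ j ih =>
    obtain ⟨F, -, h⟩ := exists_coreStage_succ_eq_ker (fun F hF => (hE F hF).2) Λ j
    simp only [h]
    exact MatrixMeasurable.projMatrix_ker
      (((ih.mul (hE F F.2).1).mul ih).add ((MatrixMeasurable.const 1).sub ih))

theorem measurableSet_coreStage_ne_bot [MeasurableSpace X]
    (hE : ∀ F ∈ E, MatrixMeasurable F ∧ ∀ x, (F x).IsHermitian) (Λ : E →ₗ[ℝ] ℝ) (j : ℕ) :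
    MeasurableSet {x | (coreStage Λ j).2 x ≠ ⊥} := by
  have h : {x | (coreStage Λ j).2 x ≠ ⊥}
      = ⋃ i, ⋃ k, {x | projMatrix ((coreStage Λ j).2 x) i k ≠ 0} := by
    ext x
    simp only [Set.mem_iUnion, Set.mem_ofPred_eq]
    rw [← not_iff_not, not_not]
    push Not
    constructor
    · intro h i k
      simp [h, projMatrix]
    · intro h
      have h0 : projMatrix ((coreStage Λ j).2 x) = 0 := Matrix.ext h
      refine eq_bot_iff.2 fun v hv => ?_
      rw [Submodule.mem_bot, ← Submodule.starProjection_eq_self_iff.2 hv,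
        ← toEuclideanLin_projMatrix, h0, map_zero, LinearMap.zero_apply]
  rw [h]
  exact MeasurableSet.iUnion fun i => MeasurableSet.iUnion fun k =>
    (matrixMeasurable_projMatrix_coreStage hE Λ j i k) (measurableSet_singleton 0).compl

end CoreStage

/-! ### Representing measures are concentrated on the core. -/

section RepresentingMeasure

variable {X : Type*} [MeasurableSpace X] {q : ℕ}
  {E : Submodule ℝ (X → Matrix (Fin q) (Fin q) ℂ)}

theorem matrixInner_nonneg_of_range_le {Φ M : Matrix (Fin q) (Fin q) ℂ} (hΦ : Φ.PosSemidef)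
    (hM : M.IsHermitian) {U : Submodule ℂ (EuclideanSpace ℂ (Fin q))}
    (hU : LinearMap.range (toEuclideanLin Φ) ≤ U) (h : ∀ v ∈ U, 0 ≤ quadForm M v) :
    0 ≤ matrixInner M Φ := by
  obtain ⟨w, hw, hr⟩ := exists_matrixInner_eq_sum_quadForm hΦ
  rw [hw M hM]
  exact Finset.sum_nonneg fun i _ => h _ ((hr U).1 hU i)

/-- The values of the density of a representing measure act on the subspaces of each stage. -/
theorem ae_range_density_le_coreStage [FiniteDimensional ℝ E]
    (hE : ∀ F ∈ E, ∀ x, (F x).IsHermitian)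
    {Λ : E →ₗ[ℝ] ℝ} {μ : PosMatrixMeasure X q} (hμ : μ ∈ representingMeasures Λ) (j : ℕ) :
    ∀ᵐ x ∂μ.traceMeasure,
      LinearMap.range (toEuclideanLin (μ.density x)) ≤ (coreStage Λ j).2 x := by
  induction j with
  | zero => exact Filter.Eventually.of_forall fun x => le_top
  | succ j ih =>
    -- Passing to a finite family leaves only finitely many exceptional null sets.
    obtain ⟨T, hT, hspan⟩ := exists_finset_span_coreCone Λ (coreStage Λ j).1 (coreStage Λ j).2
    have hz : ∀ F ∈ T, ∀ᵐ x ∂μ.traceMeasure,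
        matrixInner ((F : X → Matrix (Fin q) (Fin q) ℂ) x) (μ.density x) = 0 := by
      intro F hF
      have hF' := (mem_coreCone_coreStage_iff hE Λ j F).1 (hT hF)
      have hnn : ∀ᵐ x ∂μ.traceMeasure,
          0 ≤ matrixInner ((F : X → Matrix (Fin q) (Fin q) ℂ) x) (μ.density x) := by
        filter_upwards [ih] with x hx
        exact matrixInner_nonneg_of_range_le (μ.density_spec.posSemidef x) (hE F F.2 x) hx
          (hF'.2 x)
      have hint : ∫ x, matrixInner ((F : X → Matrix (Fin q) (Fin q) ℂ) x) (μ.density x)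
          ∂μ.traceMeasure = 0 := (hμ.2 F).symm.trans hF'.1
      exact (integral_eq_zero_iff_of_nonneg_ae hnn (hμ.1 F)).1 hint
    filter_upwards [ih, (Filter.eventually_all_finset T).2 hz] with x hx hzx
    obtain ⟨w, hw, hr⟩ := exists_matrixInner_eq_sum_quadForm (μ.density_spec.posSemidef x)
    have hwU := (hr _).1 hx
    refine (hr _).2 fun i => (mem_coreStage_succ_iff hE Λ j x _).2 ⟨hwU i, fun F hF => ?_⟩
    refine eq_zero_of_mem_span (fun G hG => ?_) (hspan hF)
    have h1 := hzx G hG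
    rw [hw _ (hE G G.2 x), Finset.sum_eq_zero_iff_of_nonneg] at h1
    · exact h1 i (Finset.mem_univ i)
    · exact fun i _ => ((mem_coreCone_coreStage_iff hE Λ j G).1 (hT hG)).2 x _ (hwU i)

variable [MeasurableSingletonClass X]

theorem PosMatrixMeasure.apply_singleton (μ : PosMatrixMeasure X q) (x : X) :
    μ.toVectorMeasure {x} = μ.traceMeasure.real {x} • μ.density x := by
  ext i j
  rw [← μ.density_spec.setIntegral {x} (measurableSet_singleton x) i j, integral_singleton]
  rfl

theorem range_apply_singleton_le_coreStage [FiniteDimensional ℝ E]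
    (hE : ∀ F ∈ E, ∀ x, (F x).IsHermitian)
    {Λ : E →ₗ[ℝ] ℝ} {μ : PosMatrixMeasure X q} (hμ : μ ∈ representingMeasures Λ) (j : ℕ) (x : X) :
    LinearMap.range (toEuclideanLin (μ.toVectorMeasure {x})) ≤ (coreStage Λ j).2 x := by
  rw [μ.apply_singleton x]
  by_cases h0 : μ.traceMeasure {x} = 0
  · simp [measureReal_def, h0]
  · have hx : LinearMap.range (toEuclideanLin (μ.density x)) ≤ (coreStage Λ j).2 x := by
      -- A point of positive trace measure cannot lie in the exceptional null set.
      by_contra hx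
      exact h0 (measure_mono_null (Set.singleton_subset_iff.2 hx)
        (ae_range_density_le_coreStage hE hμ j))
    rintro _ ⟨v, rfl⟩
    have : toEuclideanLin (μ.traceMeasure.real {x} • μ.density x) v
        = toEuclideanLin (μ.density x) ((μ.traceMeasure.real {x} : ℂ) • v) := by
      rw [← Complex.coe_smul (μ.traceMeasure.real {x}) (μ.density x), map_smul,
        LinearMap.smul_apply, map_smul]
    rw [this]
    exact hx ⟨_, rfl⟩

end RepresentingMeasure

/-! ### Functionals given by finitely many matrix point masses. -/

section FinitelyAtomic

variable {X : Type*} {q : ℕ}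

theorem matrixInner_add (M A B : Matrix (Fin q) (Fin q) ℂ) :
    matrixInner M (A + B) = matrixInner M A + matrixInner M B := by
  simp [matrixInner, Matrix.mul_add]

theorem matrixInner_smul (M A : Matrix (Fin q) (Fin q) ℂ) (c : ℝ) :
    matrixInner M (c • A) = c * matrixInner M A := by
  simp [matrixInner]

theorem matrixInner_zero (M : Matrix (Fin q) (Fin q) ℂ) : matrixInner M 0 = 0 := by
  simp [matrixInner]

/-- The functional `l` is represented by a finitely atomic measure. -/
def IsFinitelyAtomic (E : Submodule ℝ (X → Matrix (Fin q) (Fin q) ℂ)) (l : Module.Dual ℝ E) :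
    Prop :=
  ∃ (A : Finset X) (M : X → Matrix (Fin q) (Fin q) ℂ), (∀ a, (M a).PosSemidef) ∧
    (∀ a ∉ A, M a = 0) ∧
    ∀ F : E, l F = ∑ a ∈ A, matrixInner ((F : X → Matrix (Fin q) (Fin q) ℂ) a) (M a)

variable {E : Submodule ℝ (X → Matrix (Fin q) (Fin q) ℂ)}

theorem IsFinitelyAtomic.add {l m : Module.Dual ℝ E} (hl : IsFinitelyAtomic E l)
    (hm : IsFinitelyAtomic E m) : IsFinitelyAtomic E (l + m) := by
  classical
  obtain ⟨A, M, hM, hM0, hl⟩ := hl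
  obtain ⟨B, N, hN, hN0, hm⟩ := hm
  refine ⟨A ∪ B, fun a => M a + N a, fun a => (hM a).add (hN a), fun a ha => ?_, fun F => ?_⟩
  · rw [Finset.mem_union, not_or] at ha
    simp only [hM0 a ha.1, hN0 a ha.2, add_zero]
  · rw [LinearMap.add_apply, hl, hm]
    simp only [matrixInner_add, Finset.sum_add_distrib]
    congr 1
    · exact Finset.sum_subset Finset.subset_union_left
        fun a _ ha => by rw [hM0 a ha, matrixInner_zero]
    · exact Finset.sum_subset Finset.subset_union_right
        fun a _ ha => by rw [hN0 a ha, matrixInner_zero]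

theorem IsFinitelyAtomic.smul {l : Module.Dual ℝ E} (hl : IsFinitelyAtomic E l) {c : ℝ}
    (hc : 0 ≤ c) : IsFinitelyAtomic E (c • l) := by
  obtain ⟨A, M, hM, hM0, hl⟩ := hl
  refine ⟨A, fun a => c • M a, fun a => (hM a).smul hc,
    fun a ha => by simp only [hM0 a ha, smul_zero], fun F => ?_⟩
  rw [LinearMap.smul_apply, hl, smul_eq_mul, Finset.mul_sum]
  exact Finset.sum_congr rfl fun a _ => (matrixInner_smul _ _ _).symm

theorem isFinitelyAtomic_zero : IsFinitelyAtomic E 0 :=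
  ⟨∅, fun _ => 0, fun _ => PosSemidef.zero, fun _ _ => rfl, fun _ => by simp⟩

theorem isFinitelyAtomic_pointFunctional (hE : ∀ F ∈ E, ∀ x, (F x).IsHermitian) (x : X)
    (v : EuclideanSpace ℂ (Fin q)) : IsFinitelyAtomic E (pointFunctional E x v) := by
  classical
  refine ⟨{x}, Pi.single x (vecMulVec v.ofLp (star v.ofLp)), fun a => ?_, fun a ha => ?_,
    fun F => ?_⟩
  · by_cases h : a = x
    · subst h
      rw [Pi.single_eq_same]
      exact posSemidef_vecMulVec_self_star _
    · rw [Pi.single_eq_of_ne h]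
      exact PosSemidef.zero
  · exact Pi.single_eq_of_ne (by simpa using ha) _
  · rw [Finset.sum_singleton, Pi.single_eq_same, matrixInner_vecMulVec (hE F F.2 x)]
    rfl

theorem isFinitelyAtomic_of_mem_hull (hE : ∀ F ∈ E, ∀ x, (F x).IsHermitian)
    {S : Set (Module.Dual ℝ E)} (hS : ∀ s ∈ S, ∃ x v, s = pointFunctional E x v)
    {l : Module.Dual ℝ E} (hl : l ∈ PointedCone.hull ℝ S) : IsFinitelyAtomic E l :=
  Submodule.span_induction (R := {c : ℝ // 0 ≤ c})
    (p := fun (t : Module.Dual ℝ E) _ => IsFinitelyAtomic E t)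
    (fun s hs => by
      obtain ⟨x, v, rfl⟩ := hS s hs
      exact isFinitelyAtomic_pointFunctional hE x v)
    isFinitelyAtomic_zero (fun _ _ _ _ => IsFinitelyAtomic.add) (fun c _ _ h => h.smul c.2) hl

end FinitelyAtomic

/-! ### Finitely atomic measures and realization of core vectors by atoms. -/

section Atomic

variable {X : Type*} [MeasurableSpace X] {q : ℕ}

/-- The finitely atomic measure `∑ a ∈ A, M(a) δ_a`. -/
noncomputable def PosMatrixMeasure.atomic (A : Finset X) (M : X → Matrix (Fin q) (Fin q) ℂ)
    (hM : ∀ a, (M a).PosSemidef) : PosMatrixMeasure X q where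
  toVectorMeasure := ∑ a ∈ A, VectorMeasure.dirac a (M a)
  posSemidef s hs := by
    rw [FunLike.coe_sum, Finset.sum_apply]
    refine posSemidef_sum _ fun a _ => ?_
    by_cases ha : a ∈ s
    · rw [VectorMeasure.dirac_apply_of_mem hs ha]; exact hM a
    · rw [VectorMeasure.dirac_apply_of_notMem ha]; exact PosSemidef.zero

variable {E : Submodule ℝ (X → Matrix (Fin q) (Fin q) ℂ)}

theorem mem_atomSet_iff (Λ : E →ₗ[ℝ] ℝ) (x : X) : x ∈ atomSet Λ ↔ ∃ v ∈ atomSpace Λ x, v ≠ 0 := by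
  simp only [atomSet, atomSpace, Set.mem_iUnion₂, exists_prop]
  constructor
  · rintro ⟨μ, hμ, hx⟩
    have h : toEuclideanLin (μ.toVectorMeasure {x}) ≠ 0 :=
      fun h => hx ((LinearEquiv.map_eq_zero_iff _).1 h)
    obtain ⟨u, hu⟩ := DFunLike.exists_ne h
    exact ⟨_, ⟨μ, hμ, u, rfl⟩, hu⟩
  · rintro ⟨v, ⟨μ, hμ, u, rfl⟩, hv⟩
    refine ⟨μ, hμ, fun h => hv ?_⟩
    rw [h, map_zero, LinearMap.zero_apply]

theorem eq_zero_of_coreSpace_eq_bot [FiniteDimensional ℝ E] (hq : 0 < q)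
    (hE : ∀ F ∈ E, ∀ x, (F x).IsHermitian) {Λ : E →ₗ[ℝ] ℝ} (hΛ : IsMomentFunctional Λ)
    (h : ∀ x, coreSpace Λ x = ⊥) : Λ = 0 := by
  obtain ⟨μ, hμ⟩ := hΛ
  obtain ⟨n, hsp, -⟩ := exists_coreStage_eq_core hq hE Λ
  ext F
  rw [hμ.2 F, LinearMap.zero_apply]
  refine integral_eq_zero_of_ae ?_
  filter_upwards [ae_range_density_le_coreStage hE hμ n] with x hx
  rw [← hsp, h, le_bot_iff, LinearMap.range_eq_bot, LinearEquiv.map_eq_zero_iff] at hx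
  rw [hx, matrixInner_zero]
  rfl

variable [MeasurableSingletonClass X]

namespace PosMatrixMeasure

variable {A : Finset X} {M : X → Matrix (Fin q) (Fin q) ℂ} (hM : ∀ a, (M a).PosSemidef)

theorem atomic_apply_singleton {x : X} (hx : x ∉ A → M x = 0) :
    (atomic A M hM).toVectorMeasure {x} = M x := by
  rw [atomic, FunLike.coe_sum, Finset.sum_apply, Finset.sum_eq_single x]
  · exact VectorMeasure.dirac_apply_of_mem (measurableSet_singleton x) rfl
  · exact fun a _ ha => VectorMeasure.dirac_apply_of_notMem ha
  · intro h
    rw [hx h, VectorMeasure.dirac_zero, _root_.zero_apply]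

theorem traceMeasure_atomic_compl : (atomic A M hM).traceMeasure (A : Set X)ᶜ = 0 := by
  have h := (atomic A M hM).traceMeasure_real A.measurableSet.compl
  have h0 : (atomic A M hM).toVectorMeasure (A : Set X)ᶜ = 0 := by
    rw [atomic, FunLike.coe_sum, Finset.sum_apply]
    exact Finset.sum_eq_zero fun a ha => VectorMeasure.dirac_apply_of_notMem (by simpa using ha)
  rw [h0, trace_zero, Complex.zero_re] at h
  exact (measureReal_eq_zero_iff).1 h

theorem matrixInner_apply_singleton (μ : PosMatrixMeasure X q) (M : Matrix (Fin q) (Fin q) ℂ)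
    (x : X) : matrixInner M (μ.toVectorMeasure {x})
      = μ.traceMeasure.real {x} • matrixInner M (μ.density x) := by
  rw [μ.apply_singleton, matrixInner, matrixInner, Matrix.mul_smul, trace_smul, Complex.smul_re]

/-- A finite measure carried by a finite set integrates every function, so nothing is asked of `F`.
-/
theorem mIntegrable_of_compl_finset (μ : PosMatrixMeasure X q)
    (h : μ.traceMeasure (A : Set X)ᶜ = 0) (F : X → Matrix (Fin q) (Fin q) ℂ) :
    μ.MIntegrable F := by
  have hr : μ.traceMeasure.restrict A = μ.traceMeasure := Measure.restrict_eq_self_of_ae_mem h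
  rw [MIntegrable, ← hr]
  exact IntegrableOn.finset

theorem mIntegral_of_compl_finset (μ : PosMatrixMeasure X q)
    (h : μ.traceMeasure (A : Set X)ᶜ = 0) (F : X → Matrix (Fin q) (Fin q) ℂ) :
    μ.mIntegral F = ∑ a ∈ A, matrixInner (F a) (μ.toVectorMeasure {a}) := by
  have hr : μ.traceMeasure.restrict A = μ.traceMeasure := Measure.restrict_eq_self_of_ae_mem h
  rw [mIntegral]
  conv_lhs => rw [← hr]
  rw [setIntegral_finset _ IntegrableOn.finset]
  exact Finset.sum_congr rfl fun a _ => (μ.matrixInner_apply_singleton _ _).symm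

theorem atomic_mem_representingMeasures {Λ : E →ₗ[ℝ] ℝ}
    (hΛ : ∀ F : E, Λ F = ∑ a ∈ A, matrixInner ((F : X → Matrix (Fin q) (Fin q) ℂ) a) (M a)) :
    atomic A M hM ∈ representingMeasures Λ := by
  have h := traceMeasure_atomic_compl (A := A) hM
  refine ⟨fun F => mIntegrable_of_compl_finset _ h F, fun F => ?_⟩
  rw [mIntegral_of_compl_finset _ h, hΛ]
  exact Finset.sum_congr rfl fun a ha => by
    rw [atomic_apply_singleton hM fun hx => absurd ha hx]

end PosMatrixMeasure

/-- Every vector of the core space is in the range of an atom of some representing measure. -/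
theorem coreSpace_subset_atomSpace [FiniteDimensional ℝ E] (hq : 0 < q)
    (hE : ∀ F ∈ E, ∀ x, (F x).IsHermitian) {Λ : E →ₗ[ℝ] ℝ} (hΛ : IsMomentFunctional Λ) (x : X) :
    (coreSpace Λ x : Set (EuclideanSpace ℂ (Fin q))) ⊆ atomSpace Λ x := by
  intro v hv
  obtain ⟨μ, hμ⟩ := hΛ
  obtain ⟨n, hsp, -, hcone⟩ := exists_coreStage_eq_core hq hE Λ
  rw [hsp] at hv
  let S : Set (Module.Dual ℝ E) :=
    {l | ∃ y, ∃ u ∈ (coreStage Λ n).2 y, l = pointFunctional E y u}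
  -- Positivity on `S` gives `Λ F ≥ 0` by integrating against the density; if `Λ F = 0`, then `F`
  -- lies in the stationary cone and vanishes on `S`.
  obtain ⟨ε, hε, hmem⟩ := Module.Dual.exists_sub_smul_mem_hull S Λ (fun F hF hΛF => by
    have hnn : ∀ y, ∀ u ∈ (coreStage Λ n).2 y, 0 ≤ pointFunctional E y u F :=
      fun y u hu => hF _ ⟨y, u, hu, rfl⟩
    have h0 : Λ F = 0 := by
      refine le_antisymm hΛF ?_
      rw [hμ.2 F]
      refine integral_nonneg_of_ae ?_
      filter_upwards [ae_range_density_le_coreStage hE hμ n] with y hy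
      exact matrixInner_nonneg_of_range_le (μ.density_spec.posSemidef y) (hE F F.2 y) hy (hnn y)
    refine ⟨h0, ?_⟩
    rintro _ ⟨y, u, hu, rfl⟩
    exact hcone F ((mem_coreCone_coreStage_iff hE Λ n F).2 ⟨h0, hnn⟩) y u hu)
    (s := pointFunctional E x v) ⟨x, v, hv, rfl⟩
  obtain ⟨A, M, hM, hM0, hl⟩ := isFinitelyAtomic_of_mem_hull hE
    (S := S) (fun s hs => let ⟨y, u, _, h⟩ := hs; ⟨y, u, h⟩) hmem
  classical
  have hV : (vecMulVec v.ofLp (star v.ofLp)).PosSemidef := posSemidef_vecMulVec_self_star _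
  -- The mass `ε v vᴴ` subtracted at `x` is put back; `x` need not belong to `A`, hence `insert x A`
  -- below.
  let N : X → Matrix (Fin q) (Fin q) ℂ :=
    fun a => M a + if a = x then ε • vecMulVec v.ofLp (star v.ofLp) else 0
  have hN : ∀ a, (N a).PosSemidef := by
    intro a
    by_cases h : a = x
    · simp only [N, if_pos h]
      exact (hM a).add (hV.smul hε.le)
    · simp only [N, if_neg h, add_zero]
      exact hM a
  have hrep : PosMatrixMeasure.atomic (insert x A) N hN ∈ representingMeasures Λ := by
    refine PosMatrixMeasure.atomic_mem_representingMeasures hN fun F => ?_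
    have h1 : Λ F = (Λ - ε • pointFunctional E x v) F + ε * pointFunctional E x v F := by
      simp
    have h2 : ∀ a, matrixInner ((F : X → Matrix (Fin q) (Fin q) ℂ) a) (N a)
        = matrixInner ((F : X → Matrix (Fin q) (Fin q) ℂ) a) (M a)
          + if a = x then ε * pointFunctional E x v F else 0 := by
      intro a
      by_cases h : a = x
      · subst h
        simp only [N, if_true]
        rw [matrixInner_add, matrixInner_smul, matrixInner_vecMulVec (hE F F.2 a)]
        rfl
      · simp only [N, if_neg h, add_zero]
    rw [h1, hl, Finset.sum_congr rfl fun a _ => h2 a, Finset.sum_add_distrib,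
      Finset.sum_ite_eq' _ x, if_pos (Finset.mem_insert_self x A),
      Finset.sum_subset (Finset.subset_insert x A)]
    exact fun a _ ha => by rw [hM0 a ha, matrixInner_zero]
  refine Set.mem_iUnion₂.2 ⟨_, hrep, ?_⟩
  rw [PosMatrixMeasure.atomic_apply_singleton hN
    fun h => absurd (Finset.mem_insert_self x A) h]
  simp only [N, if_true]
  exact mem_range_add_smul_vecMulVec (hM x) hε v

theorem atomSpace_eq_coreSpace [FiniteDimensional ℝ E] (hq : 0 < q)
    (hE : ∀ F ∈ E, ∀ x, (F x).IsHermitian) {Λ : E →ₗ[ℝ] ℝ} (hΛ : IsMomentFunctional Λ) (x : X) :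
    atomSpace Λ x = (coreSpace Λ x : Set (EuclideanSpace ℂ (Fin q))) := by
  refine Set.Subset.antisymm (fun v hv => ?_) (coreSpace_subset_atomSpace hq hE hΛ x)
  obtain ⟨μ, hμ, hv⟩ := Set.mem_iUnion₂.1 hv
  exact (Submodule.mem_iInf _).2 fun j => range_apply_singleton_le_coreStage hE hμ j x hv

theorem mem_atomSet_iff_coreSpace_ne_bot [FiniteDimensional ℝ E] (hq : 0 < q)
    (hE : ∀ F ∈ E, ∀ x, (F x).IsHermitian) {Λ : E →ₗ[ℝ] ℝ} (hΛ : IsMomentFunctional Λ) (x : X) :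
    x ∈ atomSet Λ ↔ coreSpace Λ x ≠ ⊥ := by
  rw [mem_atomSet_iff, atomSpace_eq_coreSpace hq hE hΛ, Submodule.ne_bot_iff]
  rfl

end Atomic

theorem mainTheorem3 {X : Type*} [MeasurableSpace X] [MeasurableSingletonClass X]
    {q : ℕ} (hq : 0 < q)
    (E : Submodule ℝ (X → Matrix (Fin q) (Fin q) ℂ)) [FiniteDimensional ℝ E]
    (hE : ∀ F ∈ E, MatrixMeasurable F ∧ ∀ x, (F x).IsHermitian)
    (Λ : E →ₗ[ℝ] ℝ) (hΛ : IsMomentFunctional Λ) (hΛ0 : Λ ≠ 0) :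
    atomSet Λ = coreSet Λ ∧
      (∀ x ∈ atomSet Λ, atomSpace Λ x = (coreSpace Λ x : Set (EuclideanSpace ℂ (Fin q)))) ∧
      MeasurableSet (atomSet Λ) ∧ (atomSet Λ).Nonempty := by
  have hH : ∀ F ∈ E, ∀ x, (F x).IsHermitian := fun F hF => (hE F hF).2
  have hmem := mem_atomSet_iff_coreSpace_ne_bot hq hH hΛ
  obtain ⟨n, hsp, hset, -⟩ := exists_coreStage_eq_core hq hH Λ
  refine ⟨Set.ext fun x => (hmem x).trans (hset x).symm,
    fun x _ => atomSpace_eq_coreSpace hq hH hΛ x, ?_, ?_⟩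
  · have h : atomSet Λ = {x | (coreStage Λ n).2 x ≠ ⊥} :=
      Set.ext fun x => by rw [hmem, hsp]; rfl
    rw [h]
    exact measurableSet_coreStage_ne_bot hE Λ n
  · by_contra hne
    refine hΛ0 (eq_zero_of_coreSpace_eq_bot hq hH hΛ fun x => ?_)
    by_contra hx
    exact hne ⟨x, (hmem x).2 hx⟩
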